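/- A multicast streaming code consists of a finite source alphabet $\mathcal S$ with a distribution $p_{\mathbf s}$, a finite channel alphabet $\mathcal X$, and causal encoding functions $\mathbf x[t]=f_t(\mathbf s[0],\dots,\mathbf s[t])\in\mathcal X$, $t\ge 0$, applied to an i.i.d. source stream $(\mathbf s[t])_{t\ge 0}$ with law $p_{\mathbf s}$. For $i=1,2$, the channel of receiver $i$ erases exactly the packets $\mathbf x[j_i],\dots,\mathbf x[j_i+B_i-1]$ of one burst of length $B_i$, starting at an arbitrary time $j_i\ge 0$, and delivers all other packets; the output at an erased time is a special erasure symbol. Receiver $i$ must recover each $\mathbf s[t]$ from its channel outputs at times $0,\dots,t+T_i$, by decoding functions that do not depend on $j_i$, with $\Pr(\hat{\mathbf s}[t]\ne\mathbf s[t])=0$ for all $t\ge 0$ and all $j_i\ge 0$. The rate of the code is $R=H(\mathbf s)/\log_2|\mathcal X|$, and the multicast streaming capacity $C(B_1,T_1,B_2,T_2)$ is the maximum rate of a code that satisfies both receivers. Theorem (capacity in region (e)). Let $B_1,T_1,B_2,T_2$ be non-negative integers with $T_1\ge 1$, $B_1\le T_1<B_2\le T_2$ and $T_1+B_1\le T_2\le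 B_1+B_2$. Then $$C(B_1,T_1,B_2,T_2)=\frac{T_1}{2T_1+B_1+B_2-T_2},$$ and this maximum is attained. -/

import Mathlib

open MeasureTheory

/-- A source together with a causal streaming encoder.  The source packets `s[0], s[1], …` are
i.i.d. with law `p` on the finite alphabet `S`; the channel packets are
`x[t] = enc t (s[0], …, s[t])`, with values in the finite alphabet `X`. -/
structure StreamingCode where
  /-- the source alphabet -/
  S : Type
  /-- the channel alphabet -/
  X : Type
  [fintypeS : Fintype S]
  [fintypeX : Fintype X]
  [measurableS : MeasurableSpace S]
  [discreteS : DiscreteMeasurableSpace S]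
  /-- the law of one source packet -/
  p : PMF S
  /-- the encoding functions; the one at time `t` sees the source packets up to time `t` -/
  enc : (t : ℕ) → (Fin (t + 1) → S) → X

attribute [instance] StreamingCode.fintypeS StreamingCode.fintypeX
  StreamingCode.measurableS StreamingCode.discreteS

namespace StreamingCode

/-- The law of the i.i.d. source stream `(s[t])_{t ≥ 0}`. -/
noncomputable def sourceLaw (c : StreamingCode) : Measure (ℕ → c.S) :=
  Measure.infinitePi (fun _ : ℕ => c.p.toMeasure)

/-- The channel packet sent at time `t` when the source stream is `s`. -/
def channelPacket (c : StreamingCode) (s : ℕ → c.S) (t : ℕ) : c.X :=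
  c.enc t (fun i => s i)

/-- The channel output at time `t` when the channel erases the packets at times
`j, …, j + B - 1` and no others; `none` is the erasure symbol. -/
def received (c : StreamingCode) (B j : ℕ) (s : ℕ → c.S) (t : ℕ) : Option c.X :=
  if j ≤ t ∧ t < j + B then none else some (c.channelPacket s t)

/-- A receiver tolerates a burst of length `B` with delay `T`: there are decoding functions
`dec t`, which see the channel outputs up to time `t + T`, such that, wherever the burst starts,
every source packet is recovered with error probability zero. -/
def Tolerates (c : StreamingCode) (B T : ℕ) : Prop :=
  ∃ dec : (t : ℕ) → (Fin (t + T + 1) → Option c.X) → c.S,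
    ∀ j t : ℕ,
      c.sourceLaw {s | dec t (fun i => c.received B j s i) ≠ s t} = 0

/-- The entropy, in bits, of one source packet. -/
noncomputable def sourceEntropy (c : StreamingCode) : ℝ :=
  (∑ a : c.S, Real.negMulLog (c.p a).toReal) / Real.log 2

/-- The rate `H(s) / log₂ |X|`. -/
noncomputable def rate (c : StreamingCode) : ℝ :=
  c.sourceEntropy / Real.logb 2 (Fintype.card c.X)

end StreamingCode

/-- The rates of the codes that serve both receivers, the first with burst length `B₁` and
delay `T₁`, the second with burst length `B₂` and delay `T₂`. -/
def achievableRates (B₁ T₁ B₂ T₂ : ℕ) : Set ℝ :=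
  {R | ∃ c : StreamingCode, c.Tolerates B₁ T₁ ∧ c.Tolerates B₂ T₂ ∧ c.rate = R}

/-- `C` is the multicast streaming capacity: the maximum achievable rate. -/
def IsMulticastCapacity (B₁ T₁ B₂ T₂ : ℕ) (C : ℝ) : Prop :=
  IsGreatest (achievableRates B₁ T₁ B₂ T₂) C

/-! Converse. With zero error, two streams of positive-probability symbols that look alike to a
receiver agree at the decoded time. Cut time into periods of length `T₁ + B₂` and keep only the
first `T₁` packets of each. If the past of a period is known, its window and the next one let
receiver 2 bridge the `B₂` missing packets and decode every symbol whose deadline falls before the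
next window ends. Receiver 1, with a burst just before that window, decodes the last `B₁` symbols.
The `T₂ - T₁ - B₁` symbols between these two ranges are fixed in advance. So, up to one extra
window, `T₁` packets determine `M = 2T₁ + B₁ + B₂ - T₂` free symbols per period (`agree_period`,
`card_pow_le`), and entropy is at most the log of the support size.

Achievability. Put `k = T₂ - B₂`, `L = B₁ - k`, `D = T₁ - B₁`. A source symbol has a part `a` of
`T₁` vectors in `F^k` and a part `b` of `L` vectors in `F^T₁`, together `B₁T₁` field elements. The
`B₁T₁` shared check elements add terms meant for different receivers: `a` delayed by `B₁` plus `a`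
delayed by `T₂`, and Reed-Solomon parities of `a` plus `b` delayed by `T₂`. Each receiver can cancel
the interfering terms in the checks that it uses. A further `L B₁` elements protect `b` for receiver
1, so the rate is `T₁ / (2T₁ + L)`. -/

namespace StreamingCode

/-! ### Zero-error decoding as agreement of streams -/

/-- The streams in `A` are decodable with delay `T` from any burst of length `B`: two of them that
give the same packets outside the burst, up to time `t + T`, agree at time `t`. -/
def DecodableOn (c : StreamingCode) (A : Set (ℕ → c.S)) (B T : ℕ) : Prop :=
  ∀ j t : ℕ, ∀ s ∈ A, ∀ s' ∈ A,
    (∀ i ≤ t + T, ¬(j ≤ i ∧ i < j + B) → c.channelPacket s i = c.channelPacket s' i) → s t = s' t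

lemma channelPacket_congr (c : StreamingCode) {s s' : ℕ → c.S} {t : ℕ}
    (h : ∀ i ≤ t, s i = s' i) : c.channelPacket s t = c.channelPacket s' t := by
  unfold channelPacket
  congr 1
  funext i
  exact h i (by omega)

lemma received_congr (c : StreamingCode) {s s' : ℕ → c.S} {B j t : ℕ}
    (h : ¬(j ≤ t ∧ t < j + B) → c.channelPacket s t = c.channelPacket s' t) :
    c.received B j s t = c.received B j s' t := by
  unfold received
  split_ifs with hj
  · rfl
  · rw [h hj]

/-- The streams all of whose symbols have positive probability. -/
def supportStreams (c : StreamingCode) : Set (ℕ → c.S) := {s | ∀ i, s i ∈ c.p.support}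

lemma sourceLaw_cylinder_ne_zero (c : StreamingCode) {s : ℕ → c.S} (hs : s ∈ c.supportStreams)
    (n : ℕ) : c.sourceLaw {s' | ∀ i < n, s' i = s i} ≠ 0 := by
  have hset : {s' : ℕ → c.S | ∀ i < n, s' i = s i}
      = Set.pi (Finset.range n : Set ℕ) (fun i => {s i}) := by
    ext s'
    simp
  rw [hset, sourceLaw, Measure.infinitePi_pi _ (fun i _ => MeasurableSet.singleton _)]
  refine Finset.prod_ne_zero_iff.2 fun i _ => ?_
  rw [PMF.toMeasure_apply_singleton _ _ (MeasurableSet.singleton _)]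
  exact hs i

/-- Decoding with error probability zero never fails on a stream of symbols of positive
probability. -/
lemma Tolerates.decodableOn {c : StreamingCode} {B T : ℕ} (h : c.Tolerates B T) :
    c.DecodableOn c.supportStreams B T := by
  obtain ⟨dec, hdec⟩ := h
  have key : ∀ j t : ℕ, ∀ s ∈ c.supportStreams,
      dec t (fun i => c.received B j s i) = s t := by
    intro j t s hs
    by_contra hne
    -- Outputs up to `t + T` depend on finitely many source symbols, so a failure at `s` is a
    -- failure on a cylinder of positive mass.
    refine c.sourceLaw_cylinder_ne_zero hs (t + T + 1) (measure_mono_null ?_ (hdec j t))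
    intro s' hs'
    have hrec : (fun i : Fin (t + T + 1) => c.received B j s' i)
        = fun i : Fin (t + T + 1) => c.received B j s i := by
      funext i
      exact c.received_congr fun _ => c.channelPacket_congr fun l hl => hs' l (by omega)
    simp only [Set.mem_ofPred_eq]
    rw [hrec, hs' t (by omega)]
    exact hne
  intro j t s hs s' hs' heq
  rw [← key j t s hs, ← key j t s' hs']
  congr 1
  funext i
  exact c.received_congr (heq i (by omega))

/-- Decodability on all streams gives decoding functions; they read the position of the burst off
the erasure symbols. -/
lemma DecodableOn.tolerates {c : StreamingCode} {B T : ℕ} (h : c.DecodableOn Set.univ B T) :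
    c.Tolerates B T := by
  have : Nonempty c.S := ⟨c.p.support_nonempty.some⟩
  have key : ∀ t : ℕ, ∃ d : (Fin (t + T + 1) → Option c.X) → c.S,
      ∀ (j : ℕ) (s : ℕ → c.S), d (fun i => c.received B j s i) = s t := by
    intro t
    let f : ℕ × (ℕ → c.S) → (Fin (t + T + 1) → Option c.X) := fun q i => c.received B q.1 q.2 i
    let g : ℕ × (ℕ → c.S) → c.S := fun q => q.2 t
    have hfac : g.FactorsThrough f := by
      rintro ⟨j, s⟩ ⟨j', s'⟩ hff
      have hi : ∀ i < t + T + 1, c.received B j s i = c.received B j' s' i :=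
        fun i hi => congrFun hff ⟨i, hi⟩
      have hiff : ∀ i < t + T + 1, (j ≤ i ∧ i < j + B) ↔ (j' ≤ i ∧ i < j' + B) := by
        intro i hlt
        have := hi i hlt
        unfold received at this
        split_ifs at this <;> tauto
      refine h j t s trivial s' trivial fun i hle hnot => ?_
      have h1 := hi i (by omega)
      have h2 := (hiff i (by omega)).not.1 hnot
      unfold received at h1
      rw [if_neg hnot, if_neg h2] at h1
      exact Option.some_injective _ h1
    exact ⟨Function.extend f g (fun _ => Classical.arbitrary _),
      fun j s => hfac.extend_apply _ (j, s)⟩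
  choose dec hdec using key
  refine ⟨dec, fun j t => ?_⟩
  simp [hdec]

/-! ### Converse: periodic erasures and counting -/

section Converse

variable {c : StreamingCode} {B₁ T₁ B₂ T₂ : ℕ}

/-- Receiver 2 is given the burst that fills the gap between the two windows, receiver 1 the burst
on the last `B₁` times of that gap. Packets before the second burst need not be observed: they are
functions of symbols already known to agree. `hmid` supplies the symbols that neither burst yields.
-/
lemma DecodableOn.agree_period (h₁ : c.DecodableOn c.supportStreams B₁ T₁)
    (h₂ : c.DecodableOn c.supportStreams B₂ T₂) (hB₁B₂ : B₁ ≤ B₂)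
    {s s' : ℕ → c.S} (hs : s ∈ c.supportStreams) (hs' : s' ∈ c.supportStreams) {u : ℕ}
    (hpast : ∀ t < u, s t = s' t)
    (hwin : ∀ i < T₁, c.channelPacket s (u + i) = c.channelPacket s' (u + i))
    (hwin' : ∀ i < T₁,
      c.channelPacket s (u + (T₁ + B₂) + i) = c.channelPacket s' (u + (T₁ + B₂) + i))
    (hmid : ∀ t, u + (2 * T₁ + B₂) ≤ t + T₂ → t + B₁ < u + (T₁ + B₂) → s t = s' t) :
    ∀ t < u + (T₁ + B₂), s t = s' t := by
  have hfirst : ∀ t, t + T₂ < u + (2 * T₁ + B₂) → s t = s' t := by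
    intro t ht
    refine h₂ (u + T₁) t s hs s' hs' fun i hi hnot => ?_
    rcases lt_or_ge i u with h | h
    · exact c.channelPacket_congr fun l hl => hpast l (by omega)
    rcases lt_or_ge i (u + T₁) with h' | h'
    · have := hwin (i - u) (by omega)
      rwa [show u + (i - u) = i by omega] at this
    · have := hwin' (i - (u + (T₁ + B₂))) (by omega)
      rwa [show u + (T₁ + B₂) + (i - (u + (T₁ + B₂))) = i by omega] at this
  have hsecond : ∀ t, t + B₁ < u + (T₁ + B₂) → s t = s' t := by
    intro t ht
    rcases lt_or_ge (t + T₂) (u + (2 * T₁ + B₂)) with h | h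
    · exact hfirst t h
    · exact hmid t h ht
  intro t ht
  refine h₁ (u + T₁ + B₂ - B₁) t s hs s' hs' fun i hi hnot => ?_
  rcases lt_or_ge i (u + T₁ + B₂ - B₁) with h | h
  · exact c.channelPacket_congr fun l hl => hsecond l (by omega)
  · have := hwin' (i - (u + (T₁ + B₂))) (by omega)
    rwa [show u + (T₁ + B₂) + (i - (u + (T₁ + B₂))) = i by omega] at this

lemma DecodableOn.agree_periods (h₁ : c.DecodableOn c.supportStreams B₁ T₁)
    (h₂ : c.DecodableOn c.supportStreams B₂ T₂) (hB₁B₂ : B₁ ≤ B₂)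
    {s s' : ℕ → c.S} (hs : s ∈ c.supportStreams) (hs' : s' ∈ c.supportStreams) (N : ℕ)
    (hwin : ∀ q ≤ N, ∀ i < T₁, c.channelPacket s (q * (T₁ + B₂) + i)
      = c.channelPacket s' (q * (T₁ + B₂) + i))
    (hmid : ∀ q < N, ∀ o, 2 * T₁ + B₂ ≤ o + T₂ → o + B₁ < T₁ + B₂ →
      s (q * (T₁ + B₂) + o) = s' (q * (T₁ + B₂) + o)) :
    ∀ t < N * (T₁ + B₂), s t = s' t := by
  have key : ∀ q ≤ N, ∀ t < q * (T₁ + B₂), s t = s' t := by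
    intro q
    induction q with
    | zero => intro _ t ht; omega
    | succ q ih =>
      intro hq
      have hw' := hwin (q + 1) hq
      have hm := hmid q hq
      have hpast := ih (by omega)
      have hw := hwin q (by omega)
      rw [Nat.succ_mul] at hw' ⊢
      generalize q * (T₁ + B₂) = u at *
      refine h₁.agree_period h₂ hB₁B₂ hs hs' hpast hw hw' fun t ht1 ht2 => ?_
      rcases lt_or_ge t u with h | h
      · exact hpast t h
      · have := hm (t - u) (by omega) (by omega)
        rwa [show u + (t - u) = t by omega] at this
  exact key N le_rfl

/-- The free symbols of `N` periods inject into the packets of `N + 1` windows; the extra window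
closes the last period. -/
lemma DecodableOn.card_pow_le (h₁ : c.DecodableOn c.supportStreams B₁ T₁)
    (h₂ : c.DecodableOn c.supportStreams B₂ T₂) (hlow : T₁ + B₁ ≤ T₂)
    (hB₁T₁ : B₁ ≤ T₁) (hB₂T₂ : B₂ ≤ T₂) (hhigh : T₂ ≤ B₁ + B₂) (hB₁B₂ : B₁ ≤ B₂) (N : ℕ) :
    (Nat.card c.p.support) ^ (N * (2 * T₁ + B₁ + B₂ - T₂))
      ≤ (Fintype.card c.X) ^ ((N + 1) * T₁) := by
  classical
  set M := 2 * T₁ + B₁ + B₂ - T₂ with hM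
  set P := T₁ + B₂ with hP
  -- Enumerates the free offsets of a period by jumping over the `T₂ - B₁ - T₁` middle ones, where
  -- the stream keeps the constant value `a₀`.
  let off : Fin M → ℕ := fun m =>
    if m + T₂ < 2 * T₁ + B₂ then m else m + (T₂ - B₁ - T₁)
  have hoff_lt : ∀ m, off m < P := by
    intro m
    have := m.2
    simp only [off]
    split_ifs <;> omega
  have hoff_inj : ∀ m m', off m = off m' → m = m' := by
    intro m m' hmm
    have := m.2
    have := m'.2
    ext
    simp only [off] at hmm
    split_ifs at hmm <;> omega
  have hoff_mid : ∀ m, ¬(2 * T₁ + B₂ ≤ off m + T₂ ∧ off m + B₁ < P) := by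
    intro m
    have := m.2
    simp only [off]
    split_ifs <;> omega
  have hdivmod : ∀ q q' o o' : ℕ, o < P → o' < P → q * P + o = q' * P + o' →
      q = q' ∧ o = o' := by
    intro q q' o o' ho ho' heq
    have hq : q = q' := by
      have e1 : (q * P + o) / P = q := by
        rw [mul_comm, Nat.mul_add_div (by omega), Nat.div_eq_of_lt ho, add_zero]
      have e2 : (q' * P + o') / P = q' := by
        rw [mul_comm, Nat.mul_add_div (by omega), Nat.div_eq_of_lt ho', add_zero]
      rw [← e1, ← e2, heq]
    subst hq
    exact ⟨rfl, by omega⟩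
  let pos : Fin N × Fin M → ℕ := fun r => r.1 * P + off r.2
  have hpos : Function.Injective pos := by
    rintro ⟨q, m⟩ ⟨q', m'⟩ heq
    obtain ⟨e1, e2⟩ := hdivmod _ _ _ _ (hoff_lt m) (hoff_lt m') heq
    exact Prod.ext (Fin.ext e1) (hoff_inj _ _ e2)
  obtain ⟨a₀, ha₀⟩ := c.p.support_nonempty
  let strm : (Fin N × Fin M → c.p.support) → ℕ → c.S := fun f =>
    Function.extend pos (fun r => (f r : c.S)) (fun _ => a₀)
  have hstrm : ∀ f, strm f ∈ c.supportStreams := by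
    intro f i
    by_cases hi : ∃ r, pos r = i
    · obtain ⟨r, rfl⟩ := hi
      simp only [strm, hpos.extend_apply]
      exact (f r).2
    · simp only [strm, Function.extend_apply' _ _ _ hi]
      exact ha₀
  let obs : (Fin N × Fin M → c.p.support) → (Fin (N + 1) × Fin T₁ → c.X) := fun f r =>
    c.channelPacket (strm f) (r.1 * P + r.2)
  have hobs : Function.Injective obs := by
    intro f f' hff
    have hag := h₁.agree_periods h₂ hB₁B₂ (hstrm f) (hstrm f') N
      (fun q hq i hi => congrFun hff (⟨q, by omega⟩, ⟨i, hi⟩))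
      (fun q hq o ho1 ho2 => by
        have hno : ¬∃ r, pos r = q * P + o := by
          rintro ⟨⟨q', m⟩, hr⟩
          obtain ⟨-, e⟩ := hdivmod _ _ _ _ (hoff_lt m) (by omega) hr
          exact hoff_mid m (by rw [e]; exact ⟨ho1, ho2⟩)
        simp only [strm]
        rw [Function.extend_apply' _ _ _ hno, Function.extend_apply' _ _ _ hno])
    funext r
    have hlt : pos r < N * P := by
      have h1 : (r.1 : ℕ) + 1 ≤ N := r.1.2
      have h2 := hoff_lt r.2
      have h3 := Nat.mul_le_mul_right P h1
      rw [Nat.succ_mul] at h3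
      simp only [pos]
      omega
    have := hag (pos r) hlt
    simp only [strm, hpos.extend_apply] at this
    exact Subtype.ext this
  have := Nat.card_le_card_of_injective obs hobs
  simpa [Nat.card_fun, Nat.card_eq_fintype_card (α := c.X)] using this

end Converse

/-! ### Entropy bound and passage to the rate -/

/-- The entropy of a distribution is at most the logarithm of the size of its support. -/
lemma sum_negMulLog_le_log_card_support {α : Type*} [Fintype α] (p : PMF α) :
    ∑ a, Real.negMulLog (p a).toReal ≤ Real.log (Nat.card p.support) := by
  classical
  set n : ℝ := ((Nat.card p.support : ℕ) : ℝ) with hn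
  have hcard : n = ∑ a, if p a = 0 then (0 : ℝ) else 1 := by
    rw [hn, Nat.card_eq_fintype_card, Fintype.card_subtype, Finset.card_eq_sum_ones,
      Finset.sum_filter]
    push_cast
    refine Finset.sum_congr rfl fun a _ => ?_
    simp [PMF.mem_support_iff]
  have hpos : 0 < n := by
    have : Nonempty p.support := p.support_nonempty.to_subtype
    rw [hn]
    exact_mod_cast Nat.card_pos
  have hsum : ∑ a, (p a).toReal = 1 := by
    rw [← ENNReal.toReal_sum fun a _ => p.apply_ne_top a, ← tsum_fintype (L := .unconditional _),
      p.tsum_coe, ENNReal.toReal_one]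
  have hterm : ∀ a, Real.negMulLog (p a).toReal
      ≤ (p a).toReal * Real.log n + ((if p a = 0 then (0 : ℝ) else 1) / n - (p a).toReal) := by
    intro a
    split_ifs with h0
    · simp [h0]
    · have hx : 0 < (p a).toReal := ENNReal.toReal_pos h0 (p.apply_ne_top a)
      set x := (p a).toReal
      -- Gibbs' inequality against the uniform law on the support, term by term.
      have hl := Real.log_le_sub_one_of_pos (x := 1 / (n * x)) (by positivity)
      rw [Real.log_div one_ne_zero (by positivity), Real.log_one,
        Real.log_mul hpos.ne' hx.ne'] at hl
      have := mul_le_mul_of_nonneg_left hl hx.le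
      have he : x * (1 / (n * x) - 1) = 1 / n - x := by field_simp
      rw [he] at this
      rw [Real.negMulLog]
      nlinarith
  calc ∑ a, Real.negMulLog (p a).toReal
      ≤ ∑ a, ((p a).toReal * Real.log n
          + ((if p a = 0 then (0 : ℝ) else 1) / n - (p a).toReal)) :=
        Finset.sum_le_sum fun a _ => hterm a
    _ = Real.log n := by
        rw [Finset.sum_add_distrib, Finset.sum_sub_distrib, ← Finset.sum_mul, ← Finset.sum_div,
          ← hcard, hsum, div_self hpos.ne']
        ring

lemma rate_eq (c : StreamingCode) :
    c.rate = (∑ a : c.S, Real.negMulLog (c.p a).toReal) / Real.log (Fintype.card c.X) := by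
  have : Real.log 2 ≠ 0 := (Real.log_pos one_lt_two).ne'
  rw [rate, sourceEntropy, Real.logb, div_div_div_cancel_right₀ this]

/-- The converse: no code for both receivers has a larger rate. -/
lemma rate_le {c : StreamingCode} {B₁ T₁ B₂ T₂ : ℕ} (h₁ : c.Tolerates B₁ T₁)
    (h₂ : c.Tolerates B₂ T₂) (hT₁ : 0 < T₁) (hB₁T₁ : B₁ ≤ T₁) (hB₁B₂ : B₁ ≤ B₂)
    (hB₂T₂ : B₂ ≤ T₂) (hlow : T₁ + B₁ ≤ T₂) (hhigh : T₂ ≤ B₁ + B₂) :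
    c.rate ≤ (T₁ : ℝ) / (2 * (T₁ : ℝ) + (B₁ : ℝ) + (B₂ : ℝ) - (T₂ : ℝ)) := by
  have hMpos : 0 < 2 * T₁ + B₁ + B₂ - T₂ := by omega
  have hMcast : ((2 * T₁ + B₁ + B₂ - T₂ : ℕ) : ℝ)
      = 2 * (T₁ : ℝ) + (B₁ : ℝ) + (B₂ : ℝ) - (T₂ : ℝ) := by
    rw [Nat.cast_sub (by omega)]
    push_cast
    ring
  rw [← hMcast, rate_eq]
  have hMpos' : (0 : ℝ) < ((2 * T₁ + B₁ + B₂ - T₂ : ℕ) : ℝ) := by exact_mod_cast hMpos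
  have hcount := h₁.decodableOn.card_pow_le h₂.decodableOn hlow hB₁T₁ hB₂T₂ hhigh hB₁B₂
  generalize 2 * T₁ + B₁ + B₂ - T₂ = M at *
  have hent := sum_negMulLog_le_log_card_support c.p
  have hAne : Nonempty c.p.support := c.p.support_nonempty.to_subtype
  have hApos : 0 < Nat.card c.p.support := Nat.card_pos
  have hlog : ∀ N : ℕ, N * (M * Real.log (Nat.card c.p.support)
      - T₁ * Real.log (Fintype.card c.X)) ≤ T₁ * Real.log (Fintype.card c.X) := by
    intro N
    have h := Real.log_le_log (by positivity) (show ((Nat.card c.p.support : ℝ)) ^ (N * M)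
      ≤ (Fintype.card c.X : ℝ) ^ ((N + 1) * T₁) by exact_mod_cast hcount N)
    rw [Real.log_pow, Real.log_pow] at h
    push_cast at h
    linarith
  -- The cost of the extra window is bounded, so it vanishes as `N` grows.
  have hmain : M * Real.log (Nat.card c.p.support) ≤ T₁ * Real.log (Fintype.card c.X) := by
    by_contra hlt
    push Not at hlt
    obtain ⟨N, hN⟩ := exists_nat_gt (T₁ * Real.log (Fintype.card c.X)
      / (M * Real.log (Nat.card c.p.support) - T₁ * Real.log (Fintype.card c.X)))
    rw [div_lt_iff₀ (by linarith)] at hN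
    linarith [hlog N]
  rcases (Real.log_natCast_nonneg (Fintype.card c.X)).eq_or_lt with h0 | hpos
  -- When `log |X| = 0`, the rate is `0` by the convention for division by zero.
  · rw [← h0, div_zero]
    positivity
  · rw [div_le_div_iff₀ hpos hMpos']
    nlinarith

end StreamingCode

/-! ### Diagonally interleaved Reed-Solomon codes -/

/-- The codeword polynomial of the diagonal that starts at time `t` in the stream `a`: it takes
the value `a (t + i) i` at the node `i`. -/
noncomputable def diagonalPoly {F : Type*} [Field F] {κ : ℕ} (a : ℤ → Fin κ → F) (t : ℤ) :
    Polynomial F :=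
  Lagrange.interpolate Finset.univ (fun i : Fin κ => ((i : ℕ) : F)) (fun i => a (t + i) i)

/-- The parity symbols at time `t` of the diagonally interleaved Reed-Solomon code of
length `κ + L` and dimension `κ`. -/
noncomputable def burstParity {F : Type*} [Field F] {κ : ℕ} (L : ℕ) (a : ℤ → Fin κ → F) (t : ℤ)
    (m : Fin L) : F :=
  (diagonalPoly a (t - κ - m)).eval (((κ + m : ℕ)) : F)

lemma burstParity_congr {F : Type*} [Field F] {κ L : ℕ} {a a' : ℤ → Fin κ → F} {t : ℤ}
    (h : ∀ τ, t - κ - L < τ → τ < t → a τ = a' τ) : burstParity L a t = burstParity L a' t := by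
  funext m
  unfold burstParity diagonalPoly
  congr 2
  funext i
  rw [h _ (by omega) (by omega)]

/-- A burst of `L` missing symbols is recovered from the `κ` parities that follow it. -/
lemma burstParity_recover {F : Type*} [Field F] {κ L : ℕ}
    (hF : Set.InjOn (fun i : ℕ => (i : F)) (Set.Iio (κ + L))) {a a' : ℤ → Fin κ → F} {e : ℤ}
    (hpre : ∀ τ, e - L - κ ≤ τ → τ < e - L → a τ = a' τ)
    (hpost : ∀ τ, e ≤ τ → τ < e + κ → a τ = a' τ)
    (hpar : ∀ τ, e ≤ τ → τ < e + κ → burstParity L a τ = burstParity L a' τ) :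
    ∀ τ, e - L ≤ τ → τ < e → a τ = a' τ := by
  have hinj : Set.InjOn (fun i : Fin κ => ((i : ℕ) : F)) (Finset.univ : Finset (Fin κ)) := by
    intro i _ j _ hij
    exact Fin.ext (hF (Set.mem_Iio.2 (by omega)) (Set.mem_Iio.2 (by omega)) hij)
  have hdeg : ∀ (b : ℤ → Fin κ → F) (t : ℤ), (diagonalPoly b t).degree < (κ : ℕ) := by
    intro b t
    have := Lagrange.degree_interpolate_lt (fun i : Fin κ => b (t + i) i) hinj
    rwa [Finset.card_univ, Fintype.card_fin] at this
  have hnode : ∀ (b : ℤ → Fin κ → F) (t : ℤ) (i : Fin κ),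
      (diagonalPoly b t).eval ((i : ℕ) : F) = b (t + i) i := fun b t i =>
    Lagrange.eval_interpolate_at_node (fun i : Fin κ => b (t + i) i) hinj (Finset.mem_univ i)
  intro τ hτ hτe
  funext i
  -- The diagonal through coordinate `i` at time `τ`. Its codeword has one coordinate per time, so
  -- the burst hits at most `L` of the `κ + L`.
  set t₀ : ℤ := τ - i with ht₀
  have hval : ∀ m : ℕ, m < κ + L →
      (e - L - κ ≤ t₀ + m ∧ t₀ + m < e - L ∧ m < κ ∨ e ≤ t₀ + m ∧ t₀ + m < e + κ) →
      (diagonalPoly a t₀).eval (m : F) = (diagonalPoly a' t₀).eval (m : F) := by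
    intro m hm hcase
    rcases lt_or_ge m κ with hmk | hmk
    · have h1 := hnode a t₀ ⟨m, hmk⟩
      have h2 := hnode a' t₀ ⟨m, hmk⟩
      simp only at h1 h2
      rw [h1, h2]
      rcases hcase with h | h
      · rw [hpre _ h.1 h.2.1]
      · rw [hpost _ h.1 h.2]
    · rcases hcase with h | h
      · omega
      · have := congrFun (hpar _ h.1 h.2) ⟨m - κ, by omega⟩
        unfold burstParity at this
        simp only at this
        rwa [show t₀ + (m : ℤ) - κ - ((m - κ : ℕ) : ℤ) = t₀ by omega,
          show κ + (m - κ) = m by omega] at this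
  -- `κ` known coordinates determine a polynomial of degree below `κ`. A diagonal that starts before
  -- the burst uses those on both sides of it; one that starts inside uses the first `κ` after it.
  obtain ⟨G, hGcard, hG⟩ : ∃ G : Finset ℕ, G.card = κ ∧ ∀ m ∈ G, m < κ + L ∧
      (e - L - κ ≤ t₀ + m ∧ t₀ + m < e - L ∧ m < κ ∨ e ≤ t₀ + m ∧ t₀ + m < e + κ) := by
    have hi := i.2
    rcases lt_or_ge t₀ (e - L) with hlt | hge
    · refine ⟨Finset.range (e - L - t₀).toNat ∪ Finset.Ico (e - t₀).toNat (κ + L), ?_, ?_⟩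
      · rw [Finset.card_union_of_disjoint, Finset.card_range, Nat.card_Ico]
        · omega
        · rw [Finset.disjoint_left]
          intro m h1 h2
          rw [Finset.mem_range] at h1
          rw [Finset.mem_Ico] at h2
          omega
      · intro m hm
        rw [Finset.mem_union, Finset.mem_range, Finset.mem_Ico] at hm
        omega
    · refine ⟨Finset.Ico (e - t₀).toNat ((e - t₀).toNat + κ), ?_, ?_⟩
      · rw [Nat.card_Ico]
        omega
      · intro m hm
        rw [Finset.mem_Ico] at hm
        omega
  have hpoly : diagonalPoly a t₀ = diagonalPoly a' t₀ := by
    refine Polynomial.eq_of_degrees_lt_of_eval_index_eq (v := fun m : ℕ => (m : F)) G ?_ ?_ ?_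
      fun m hm => hval m (hG m hm).1 (hG m hm).2
    · exact hF.mono fun m hm => (hG m hm).1
    · rw [hGcard]
      exact hdeg a t₀
    · rw [hGcard]
      exact hdeg a' t₀
  have h1 := hnode a t₀ i
  have h2 := hnode a' t₀ i
  rw [hpoly, h2] at h1
  rw [show t₀ + (i : ℤ) = τ by omega] at h1
  exact h1.symm

/-! ### Systematic codes with uniform source -/

/-- A finite stream prefix, extended by zeros to all times. -/
def zeroExtend {S : Type*} [Zero S] {n : ℕ} (h : Fin n → S) (t : ℤ) : S :=
  if ht : 0 ≤ t ∧ t < n then h ⟨t.toNat, by omega⟩ else 0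

/-- The code with uniform source whose packet at time `t` is `f t` of the stream up to time `t`,
extended by zeros. -/
noncomputable def uniformCode (S X : Type) [Fintype S] [Fintype X] [Zero S]
    (f : ℤ → (ℤ → S) → X) : StreamingCode :=
  letI : Nonempty S := ⟨0⟩
  { S := S
    X := X
    measurableS := ⊤
    discreteS := @DiscreteMeasurableSpace.mk S ⊤ fun _ => trivial
    p := PMF.uniformOfFintype S
    enc := fun t h => f t (zeroExtend h) }

lemma uniformCode_rate (S X : Type) [Fintype S] [Fintype X] [Zero S] (f : ℤ → (ℤ → S) → X) :
    (uniformCode S X f).rate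
      = Real.log (Fintype.card S) / Real.log (Fintype.card X) := by
  rw [StreamingCode.rate_eq]
  have : Nonempty S := ⟨0⟩
  have hn : (0 : ℝ) < Fintype.card S := by exact_mod_cast Fintype.card_pos
  congr 1
  change ∑ a : S, Real.negMulLog ((PMF.uniformOfFintype S) a).toReal = _
  simp only [PMF.uniformOfFintype_apply, ENNReal.toReal_inv, ENNReal.toReal_natCast,
    Finset.sum_const, Finset.card_univ, nsmul_eq_mul, Real.negMulLog, Real.log_inv]
  field_simp

/-- To tolerate bursts of length `B` with delay `T`, it is enough that two streams on `ℤ` that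
agree before the burst and whose packets agree after it up to time `t + T` agree at time `t`. -/
lemma uniformCode_tolerates {S X : Type} [Fintype S] [Fintype X] [Zero S]
    {f : ℤ → (ℤ → S) → X} {B T : ℕ}
    (hcausal : ∀ t a a', (∀ τ ≤ t, a τ = a' τ) → f t a = f t a')
    (hsys : ∀ t a a', f t a = f t a' → a t = a' t)
    (h : ∀ j t : ℤ, ∀ a a' : ℤ → S, j ≤ t → t < j + B → (∀ τ < j, a τ = a' τ) →
      (∀ τ, j + B ≤ τ → τ ≤ t + T → f τ a = f τ a') → a t = a' t) :
    (uniformCode S X f).Tolerates B T := by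
  refine StreamingCode.DecodableOn.tolerates ?_
  set ext : (ℕ → S) → ℤ → S := fun s t => if 0 ≤ t then s t.toNat else 0 with hextdef
  have hpacket : ∀ (s : ℕ → S) (t : ℕ),
      (uniformCode S X f).channelPacket s t = f t (ext s) := by
    intro s t
    refine hcausal t _ _ fun τ hτ => ?_
    simp only [zeroExtend, ext]
    by_cases h0 : 0 ≤ τ
    · rw [dif_pos ⟨h0, by push_cast; omega⟩, if_pos h0]
    · rw [dif_neg (by omega), if_neg h0]
  intro j t (s : ℕ → S) _ (s' : ℕ → S) _ heq
  have hout : ∀ i : ℕ, i ≤ t + T → ¬(j ≤ i ∧ i < j + B) →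
      f i (ext s) = f i (ext s') := by
    intro i hi hnot
    exact (hpacket s i).symm.trans ((heq i hi hnot).trans (hpacket s' i))
  have hext : ∀ (s : ℕ → S) (i : ℕ), ext s i = s i := by
    intro s i
    simp [ext]
  refine (hext s t).symm.trans (Eq.trans ?_ (hext s' t))
  by_cases ht : j ≤ t ∧ t < j + B
  · refine h j t _ _ (by omega) (by omega) (fun τ hτ => ?_) (fun τ hτ1 hτ2 => ?_)
    · by_cases h0 : 0 ≤ τ
      · lift τ to ℕ using h0
        exact hsys _ _ _ (hout τ (by omega) (by omega))
      · simp only [ext, if_neg h0]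
    · lift τ to ℕ using (by omega)
      exact hout τ (by omega) (by omega)
  · exact hsys _ _ _ (hout t (by omega) ht)

/-- Repetition with delay `T` serves the burst length `B = T`. -/
lemma exists_repetitionCode (T₁ T : ℕ) :
    ∃ c : StreamingCode, c.Tolerates 0 T₁ ∧ c.Tolerates T T ∧ c.rate = 1 / 2 := by
  let f : ℤ → (ℤ → ZMod 2) → ZMod 2 × ZMod 2 := fun t a => (a t, a (t - T))
  have hcausal : ∀ t a a', (∀ τ ≤ t, a τ = a' τ) → f t a = f t a' := by
    intro t a a' h
    simp only [f]
    rw [h t le_rfl, h (t - T) (by omega)]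
  have hsys : ∀ t a a', f t a = f t a' → a t = a' t := fun t a a' h => congrArg Prod.fst h
  refine ⟨uniformCode _ _ f, uniformCode_tolerates hcausal hsys ?_,
    uniformCode_tolerates hcausal hsys ?_, ?_⟩
  · intro j t a a' h1 h2
    omega
  · intro j t a a' h1 h2 _ h
    have := congrArg Prod.snd (h (t + T) (by omega) le_rfl)
    simpa [f] using this
  · rw [uniformCode_rate]
    simp only [Fintype.card_prod, ZMod.card]
    have : Real.log 2 ≠ 0 := (Real.log_pos one_lt_two).ne'
    rw [Nat.cast_mul, Nat.cast_ofNat, Real.log_mul two_ne_zero two_ne_zero]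
    field_simp
    norm_num

/-! ### The superposed code and its two decoders -/

section MulticastCode

variable (F : Type) (k L D : ℕ)

/-- The index set of size `k + L + D` of the superposed code. -/
abbrev UrgentIndex : Type := Fin (k + L) ⊕ Fin D

/-- One source symbol of the superposed code. -/
abbrev MulticastSource : Type :=
  (UrgentIndex k L D → Fin k → F) × (Fin L → UrgentIndex k L D → F)

/-- One channel packet of the superposed code: the source symbol, the two groups of rows shared
by the receivers, and the rows for the first receiver only. -/
abbrev MulticastPacket : Type :=
  MulticastSource F k L D ×
    ((UrgentIndex k L D → Fin k → F) × (Fin L → UrgentIndex k L D → F)) ×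
      (Fin L → Fin (k + L) → F)

lemma card_multicastSource [Fintype F] :
    Fintype.card (MulticastSource F k L D) = Fintype.card F ^ ((k + L) * (k + L + D)) := by
  simp only [Fintype.card_prod, Fintype.card_fun, Fintype.card_sum, Fintype.card_fin]
  ring

lemma card_multicastPacket [Fintype F] :
    Fintype.card (MulticastPacket F k L D)
      = Fintype.card F ^ ((k + L) * (2 * (k + L + D) + L)) := by
  simp only [Fintype.card_prod, Fintype.card_fun, Fintype.card_sum, Fintype.card_fin]
  ring

variable {F k L D} [Field F]

/-- The encoder of the superposed code. -/
noncomputable def multicastEnc (Δ : ℕ) (t : ℤ) (s : ℤ → MulticastSource F k L D) :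
    MulticastPacket F k L D :=
  (s t,
    (fun w => (s (t - (k + L : ℕ))).1 w + (s (t - Δ)).1 w,
      fun l w => burstParity L (fun τ => (s τ).1 w) t l + (s (t - Δ)).2 l w),
    fun l i => burstParity (k + L) (fun τ j => (s τ).2 l (Sum.inr j)) t i
      + (s (t - (k + L + D : ℕ))).2 l (Sum.inl i))

lemma multicastEnc_causal {Δ : ℕ} (t : ℤ) (s s' : ℤ → MulticastSource F k L D)
    (h : ∀ τ ≤ t, s τ = s' τ) : multicastEnc Δ t s = multicastEnc Δ t s' := by
  have hp : ∀ w, burstParity L (fun τ => (s τ).1 w) t = burstParity L (fun τ => (s' τ).1 w) t :=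
    fun w => burstParity_congr fun τ _ hτ => by rw [h τ hτ.le]
  have hq : ∀ l, burstParity (k + L) (fun τ j => (s τ).2 l (Sum.inr j)) t
      = burstParity (k + L) (fun τ j => (s' τ).2 l (Sum.inr j)) t :=
    fun l => burstParity_congr fun τ _ hτ => by rw [h τ hτ.le]
  simp only [multicastEnc, hp, hq]
  rw [h t le_rfl, h (t - (k + L : ℕ)) (by omega), h (t - Δ) (by omega),
    h (t - (k + L + D : ℕ)) (by omega)]

section Rows

variable {Δ : ℕ} {t : ℤ} {s s' : ℤ → MulticastSource F k L D}

lemma multicastEnc_source (h : multicastEnc Δ t s = multicastEnc Δ t s') : s t = s' t :=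
  congrArg Prod.fst h

lemma multicastEnc_repetition (h : multicastEnc Δ t s = multicastEnc Δ t s') :
    (s (t - (k + L : ℕ))).1 + (s (t - Δ)).1 = (s' (t - (k + L : ℕ))).1 + (s' (t - Δ)).1 :=
  congrArg (fun x => x.2.1.1) h

lemma multicastEnc_parity (h : multicastEnc Δ t s = multicastEnc Δ t s') (l : Fin L)
    (w : UrgentIndex k L D) :
    burstParity L (fun τ => (s τ).1 w) t l + (s (t - Δ)).2 l w
      = burstParity L (fun τ => (s' τ).1 w) t l + (s' (t - Δ)).2 l w :=
  congrArg (fun x => x.2.1.2 l w) h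

lemma multicastEnc_urgent (h : multicastEnc Δ t s = multicastEnc Δ t s') (l : Fin L)
    (i : Fin (k + L)) :
    burstParity (k + L) (fun τ j => (s τ).2 l (Sum.inr j)) t i
        + (s (t - (k + L + D : ℕ))).2 l (Sum.inl i)
      = burstParity (k + L) (fun τ j => (s' τ).2 l (Sum.inr j)) t i
        + (s' (t - (k + L + D : ℕ))).2 l (Sum.inl i) :=
  congrArg (fun x => x.2.2 l i) h

end Rows

/-- The first receiver: burst length `k + L`, delay `k + L + D`. -/
lemma multicastEnc_recover_short
    (hF : Set.InjOn (fun i : ℕ => (i : F)) (Set.Iio (D + (k + L)))) {Δ : ℕ}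
    (hΔ : 2 * (k + L) + D ≤ Δ) {j t : ℤ} {s s' : ℤ → MulticastSource F k L D}
    (hjt : j ≤ t) (htj : t < j + (k + L : ℕ)) (hpast : ∀ τ < j, s τ = s' τ)
    (hrec : ∀ τ, j + (k + L : ℕ) ≤ τ → τ ≤ t + (k + L + D : ℕ) →
      multicastEnc Δ τ s = multicastEnc Δ τ s') : s t = s' t := by
  have hfuture : ∀ τ, j + (k + L : ℕ) ≤ τ → τ ≤ t + (k + L + D : ℕ) → s τ = s' τ :=
    fun τ h1 h2 => multicastEnc_source (hrec τ h1 h2)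
  have ha : (s t).1 = (s' t).1 := by
    have := multicastEnc_repetition (hrec (t + (k + L : ℕ)) (by omega) (by omega))
    -- The delay `Δ` is at least twice the burst length, so the interfering term predates the burst.
    rw [hpast (t + (k + L : ℕ) - Δ) (by omega), add_sub_cancel_right] at this
    exact add_right_cancel this
  have hz : ∀ l : Fin L, ∀ τ, j ≤ τ → τ < j + (k + L : ℕ) →
      (fun i => (s τ).2 l (Sum.inr i)) = fun i => (s' τ).2 l (Sum.inr i) := by
    intro l τ h1 h2
    refine burstParity_recover (L := k + L) hF (e := j + (k + L : ℕ))
      (a := fun τ i => (s τ).2 l (Sum.inr i)) (a' := fun τ i => (s' τ).2 l (Sum.inr i))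
      (fun σ _ hσ => ?_) (fun σ hσ hσ' => ?_) (fun σ hσ hσ' => ?_) τ (by omega) h2
    · rw [hpast σ (by omega)]
    · rw [hfuture σ hσ (by omega)]
    · funext i
      have := multicastEnc_urgent (hrec σ hσ (by omega)) l i
      rw [hpast (σ - (k + L + D : ℕ)) (by omega)] at this
      exact add_right_cancel this
  have hu : ∀ l i, (s t).2 l (Sum.inl i) = (s' t).2 l (Sum.inl i) := by
    intro l i
    have := multicastEnc_urgent (hrec (t + (k + L + D : ℕ)) (by omega) le_rfl) l i
    rw [add_sub_cancel_right, burstParity_congr (a' := fun τ i => (s' τ).2 l (Sum.inr i))] at this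
    · exact add_left_cancel this
    · intro τ _ hτ
      rcases lt_or_ge τ j with h | h
      · rw [hpast τ h]
      rcases lt_or_ge τ (j + (k + L : ℕ)) with h' | h'
      · exact hz l τ h h'
      · rw [hfuture τ h' hτ.le]
  refine Prod.ext ha ?_
  funext l w
  rcases w with i | i
  · exact hu l i
  · exact congrFun (hz l t hjt htj) i

/-- The second receiver: burst length `B`, delay `B + k`. -/
lemma multicastEnc_recover_long
    (hF : Set.InjOn (fun i : ℕ => (i : F)) (Set.Iio (k + L))) {B : ℕ}
    {j t : ℤ} {s s' : ℤ → MulticastSource F k L D}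
    (hjt : j ≤ t) (hpast : ∀ τ < j, s τ = s' τ)
    (hrec : ∀ τ, j + B ≤ τ → τ ≤ t + (B + k : ℕ) →
      multicastEnc (B + k) τ s = multicastEnc (B + k) τ s') : s t = s' t := by
  have hfuture : ∀ τ, j + B ≤ τ → τ ≤ t + (B + k : ℕ) → s τ = s' τ :=
    fun τ h1 h2 => multicastEnc_source (hrec τ h1 h2)
  -- In the first `k` packets after the burst, the terms of delay `B + k` predate the burst.
  -- Cancelling them leaves copies of `k` erased symbols, and only the last `L` remain for the
  -- parities.
  have hrep : ∀ τ, j + B - (k + L : ℕ) ≤ τ → τ < j + B - L → (s τ).1 = (s' τ).1 := by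
    intro τ h1 h2
    have := multicastEnc_repetition (hrec (τ + (k + L : ℕ)) (by omega) (by omega))
    rw [hpast (τ + (k + L : ℕ) - (B + k : ℕ)) (by omega), add_sub_cancel_right] at this
    exact add_right_cancel this
  have hmds : ∀ τ, j + B - L ≤ τ → τ < j + B → (s τ).1 = (s' τ).1 := by
    intro τ h1 h2
    funext w
    refine burstParity_recover (L := L) hF (e := j + B)
      (a := fun τ => (s τ).1 w) (a' := fun τ => (s' τ).1 w)
      (fun σ hσ hσ' => ?_) (fun σ hσ hσ' => ?_) (fun σ hσ hσ' => ?_) τ h1 h2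
    · rw [hrep σ (by omega) hσ']
    · rw [hfuture σ hσ (by omega)]
    · funext l
      have := multicastEnc_parity (hrec σ hσ (by omega)) l w
      rw [hpast (σ - (B + k : ℕ)) (by omega)] at this
      exact add_right_cancel this
  have ha : ∀ τ, j + B - (k + L : ℕ) ≤ τ → τ ≤ t + (B + k : ℕ) → (s τ).1 = (s' τ).1 := by
    intro τ h1 h2
    rcases lt_or_ge τ (j + B - L) with h | h
    · exact hrep τ h1 h
    rcases lt_or_ge τ (j + B) with h' | h'
    · exact hmds τ h h'
    · rw [hfuture τ h' h2]
  -- At the deadline the roles swap: the first parts just before it are known, so their terms cancel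
  -- and the delayed symbol is exposed.
  have hlast := hrec (t + (B + k : ℕ)) (by omega) le_rfl
  refine Prod.ext ?_ ?_
  · have := multicastEnc_repetition hlast
    rw [ha (t + (B + k : ℕ) - (k + L : ℕ)) (by omega) (by omega), add_sub_cancel_right] at this
    exact add_left_cancel this
  · funext l w
    have := multicastEnc_parity hlast l w
    rw [add_sub_cancel_right, burstParity_congr (a' := fun τ => (s' τ).1 w)] at this
    · exact add_left_cancel this
    · intro τ h1 h2
      rw [ha τ (by omega) h2.le]

end MulticastCode

/-! ### Choice of field and parameters -/

/-- Every initial segment of `ℕ` embeds in a finite field. -/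
lemma exists_finite_field_natCast_injOn (n : ℕ) :
    ∃ (F : Type) (_ : Field F) (_ : Fintype F),
      Set.InjOn (fun i : ℕ => (i : F)) (Set.Iio n) := by
  obtain ⟨p, hp, hprime⟩ := Nat.exists_infinite_primes n
  have : Fact p.Prime := ⟨hprime⟩
  refine ⟨ZMod p, inferInstance, inferInstance, fun i hi j hj hij => ?_⟩
  rw [Set.mem_Iio] at hi hj
  have := (ZMod.natCast_eq_natCast_iff' i j p).1 hij
  rwa [Nat.mod_eq_of_lt (by omega), Nat.mod_eq_of_lt (by omega)] at this

/-- Achievability for a positive first burst length `k + L`. -/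
lemma exists_multicastCode (F : Type) [Field F] [Fintype F] (k L D B : ℕ)
    (hF : Set.InjOn (fun i : ℕ => (i : F)) (Set.Iio (D + (k + L))))
    (hkL : 0 < k + L) (hB : 2 * (k + L) + D ≤ B + k) :
    ∃ c : StreamingCode, c.Tolerates (k + L) (k + L + D) ∧ c.Tolerates B (B + k) ∧
      c.rate = ((k + L + D : ℕ) : ℝ) / ((2 * (k + L + D) + L : ℕ) : ℝ) := by
  refine ⟨uniformCode (MulticastSource F k L D) (MulticastPacket F k L D)
    (multicastEnc (B + k)), ?_, ?_, ?_⟩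
  · refine uniformCode_tolerates multicastEnc_causal (fun _ _ _ => multicastEnc_source) ?_
    intro j t a a' hjt htj hpast hrec
    exact multicastEnc_recover_short hF hB hjt htj hpast hrec
  · refine uniformCode_tolerates multicastEnc_causal (fun _ _ _ => multicastEnc_source) ?_
    intro j t a a' hjt _ hpast hrec
    exact multicastEnc_recover_long (hF.mono (Set.Iio_subset_Iio (by omega))) hjt
      hpast hrec
  · have hlog : Real.log (Fintype.card F) ≠ 0 :=
      (Real.log_pos (by exact_mod_cast Fintype.one_lt_card)).ne'
    have hkL' : ((k + L : ℕ) : ℝ) ≠ 0 := by exact_mod_cast hkL.ne'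
    rw [uniformCode_rate, card_multicastSource, card_multicastPacket, Nat.cast_pow, Nat.cast_pow, Real.log_pow, Real.log_pow,
      mul_div_mul_right _ _ hlog, Nat.cast_mul, Nat.cast_mul, mul_div_mul_left _ _ hkL']

theorem theorem5 (B₁ T₁ B₂ T₂ : ℕ)
    (hT₁ : 0 < T₁)
    (hB₁T₁ : B₁ ≤ T₁) (hT₁B₂ : T₁ < B₂)
    (hB₂T₂ : B₂ ≤ T₂)
    (hlow : T₁ + B₁ ≤ T₂) (hhigh : T₂ ≤ B₁ + B₂) :
    IsMulticastCapacity B₁ T₁ B₂ T₂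
      ((T₁ : ℝ) / (2 * (T₁ : ℝ) + (B₁ : ℝ) + (B₂ : ℝ) - (T₂ : ℝ))) := by
  constructor
  -- For `B₁ = 0` the superposed code has one-element alphabets, hence no useful rate; here `T₂ =
  -- B₂` and the capacity is `1/2`.
  · rcases Nat.eq_zero_or_pos B₁ with rfl | hB₁
    · obtain rfl : T₂ = B₂ := by omega
      obtain ⟨c, h₁, h₂, hr⟩ := exists_repetitionCode T₁ T₂
      refine ⟨c, h₁, h₂, hr.trans ?_⟩
      have : (T₁ : ℝ) ≠ 0 := by exact_mod_cast hT₁.ne'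
      push_cast
      rw [add_zero, add_sub_cancel_right]
      field_simp
    · obtain ⟨k, rfl⟩ := Nat.exists_eq_add_of_le hB₂T₂
      obtain ⟨L, rfl⟩ : ∃ L, B₁ = k + L := Nat.exists_eq_add_of_le (by omega)
      obtain ⟨D, rfl⟩ := Nat.exists_eq_add_of_le hB₁T₁
      obtain ⟨F, _, _, hF⟩ := exists_finite_field_natCast_injOn (D + (k + L))
      obtain ⟨c, h₁, h₂, hr⟩ := exists_multicastCode F k L D B₂ hF hB₁ (by omega)
      refine ⟨c, h₁, h₂, hr.trans ?_⟩
      push_cast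
      congr 1
      ring
  · rintro R ⟨c, h₁, h₂, rfl⟩
    exact c.rate_le h₁ h₂ hT₁ hB₁T₁ (by omega) hB₂T₂ hlow hhigh
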